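/- Fix a set of atoms (of any cardinality). A rule $r$ consists of a head atom $\mathrm{head}(r)$ and two finite sets of atoms, its positive subgoals $\mathrm{pos}(r)$ and its negated subgoals $\mathrm{neg}(r)$; a (normal logic) program is an arbitrary, possibly infinite, set of rules. Write $a\leftarrow$ for the rule with head $a$ and no subgoals. For a set $X$ of atoms, the reduct $P^X$ of a program $P$ is obtained from $P$ by deleting every rule $r$ with $\mathrm{neg}(r)\cap X\neq\emptyset$ and removing all negated subgoals from the remaining rules. The set $X$ is an answer set for $P$ if $X$ is the least set $Y$ of atoms such that $\mathrm{head}(r)\in Y$ for every rule $r\in P^X$ with $\mathrm{pos}(r)\subseteq Y$. For an atom $a$, let $P_a^+$ and $P_a^-$ be the (simultaneously) smallest sets of atoms such that $a\in P_a^+$ and, for every rule $r\in P$: if $\mathrm{head}(r)\in P_a^+$ then $\mathrm{pos}(r)\subseteq P_a^+$ and $\mathrm{neg}(r)\subseteq P_a^-$; if $\mathrm{head}(r)\in P_a^-$ then $\mathrm{pos}(r)\subseteq P_a^-$ and $\mathrm{neg}(r)\subseteq P_a^+$. The program $P$ is order-consistent if there is a function $\lambda$ from atoms to ordinals such that $\lambda(b)<\lambda(a)$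 whenever $b\in P_a^+\cap P_a^-$. **Corollary (Cumulativity Corollary).** If an atom $a$ belongs to every answer set for an order-consistent program $P$, then the programs $P$ and $P\cup\{a\leftarrow\}$ have the same answer sets; that is, for every set $X$ of atoms, $X$ is an answer set for $P$ if and only if $X$ is an answer set for $P\cup\{a\leftarrow\}$. -/

import Mathlib

universe u

namespace LogicProgram

/-- A rule of a normal logic program: a head atom, a finite set of positive subgoals and a
finite set of negated subgoals. -/
structure Rule (Atom : Type u) where
  head : Atom
  pos : Finset Atom
  neg : Finset Atom

/-- A normal logic program is an arbitrary (possibly infinite) set of rules. -/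
abbrev Program (Atom : Type u) := Set (Rule Atom)

variable {Atom : Type u}

/-- The rule `a ←`, without subgoals. -/
def fact (a : Atom) : Rule Atom where
  head := a
  pos := ∅
  neg := ∅

/-- A program is positive if no rule has negated subgoals. -/
def IsPositive (P : Program Atom) : Prop :=
  ∀ r ∈ P, r.neg = ∅

/-- `X` is closed under the positive program `P`. (Only used for positive programs.) -/
def IsClosedUnder (P : Program Atom) (X : Set Atom) : Prop :=
  ∀ r ∈ P, (∀ b ∈ r.pos, b ∈ X) → r.head ∈ X

/-- `X` is the answer set for the positive program `P`: the least set of atoms closed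
under `P`. (Only used for positive programs.) -/
def IsPositiveAnswerSet (P : Program Atom) (X : Set Atom) : Prop :=
  IsLeast {Y : Set Atom | IsClosedUnder P Y} X

/-- The reduct of `P` relative to `X`: drop the rules with a negated subgoal in `X`, and
remove the negated subgoals from the remaining rules. -/
def reduct (P : Program Atom) (X : Set Atom) : Program Atom :=
  {r' | ∃ r ∈ P, (∀ c ∈ r.neg, c ∉ X) ∧ r' = { head := r.head, pos := r.pos, neg := ∅ }}

theorem isPositive_reduct (P : Program Atom) (X : Set Atom) : IsPositive (reduct P X) := by
  rintro _ ⟨r, -, -, rfl⟩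
  rfl

/-- `X` is an answer set (stable model) for `P` if it is the answer set for the reduct of `P`
relative to `X`. -/
def IsAnswerSet (P : Program Atom) (X : Set Atom) : Prop :=
  IsPositiveAnswerSet (reduct P X) X

/-- `DependsOn P a s b`: the atom `a` depends on `b` in `P`, positively if `s = true` and
negatively if `s = false`. -/
inductive DependsOn (P : Program Atom) (a : Atom) : Bool → Atom → Prop
  | self : DependsOn P a true a
  | pos {s : Bool} {r : Rule Atom} {b : Atom} (hr : r ∈ P) (hb : b ∈ r.pos)
      (h : DependsOn P a s r.head) : DependsOn P a s b
  | neg {s : Bool} {r : Rule Atom} {b : Atom} (hr : r ∈ P) (hb : b ∈ r.neg)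
      (h : DependsOn P a s r.head) : DependsOn P a (!s) b

/-- The set of atoms on which `a` depends positively in `P`. -/
def posDep (P : Program Atom) (a : Atom) : Set Atom := {b | DependsOn P a true b}

/-- The set of atoms on which `a` depends negatively in `P`. -/
def negDep (P : Program Atom) (a : Atom) : Set Atom := {b | DependsOn P a false b}

/-- The simultaneous closure conditions that define the pair of dependency sets of `a`. -/
def IsDepClosed (P : Program Atom) (a : Atom) (S T : Set Atom) : Prop :=
  a ∈ S ∧ ∀ r ∈ P,
    (r.head ∈ S → (∀ b ∈ r.pos, b ∈ S) ∧ ∀ c ∈ r.neg, c ∈ T) ∧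
    (r.head ∈ T → (∀ b ∈ r.pos, b ∈ T) ∧ ∀ c ∈ r.neg, c ∈ S)

/-- The pair `(posDep P a, negDep P a)` is the smallest pair of sets satisfying the closure
conditions. -/
theorem isLeast_dep (P : Program Atom) (a : Atom) :
    IsLeast {p : Set Atom × Set Atom | IsDepClosed P a p.1 p.2}
      (posDep P a, negDep P a) := by
  refine ⟨⟨.self, fun r hr => ⟨fun h => ⟨fun b hb => .pos hr hb h, fun c hc => .neg hr hc h⟩,
    fun h => ⟨fun b hb => .pos hr hb h, fun c hc => .neg hr hc h⟩⟩⟩, ?_⟩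
  rintro ⟨S, T⟩ ⟨ha, hcl⟩
  have key : ∀ s b, DependsOn P a s b → b ∈ (if s then S else T) := by
    intro s b h
    induction h with
    | self => exact ha
    | @pos s r b hr hb _ ih =>
      cases s
      · exact ((hcl r hr).2 ih).1 b hb
      · exact ((hcl r hr).1 ih).1 b hb
    | @neg s r b hr hb _ ih =>
      cases s
      · exact ((hcl r hr).2 ih).2 b hb
      · exact ((hcl r hr).1 ih).2 b hb
  exact ⟨fun b h => key true b h, fun b h => key false b h⟩

/-- `P` is order-consistent if some level mapping (a function from atoms to ordinals) puts `b`
strictly below `a` whenever `a` depends both positively and negatively on `b`. -/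
def IsOrderConsistent (P : Program Atom) : Prop :=
  ∃ level : Atom → Ordinal.{u}, ∀ a b : Atom,
    b ∈ posDep P a ∩ negDep P a → level b < level a

end LogicProgram

namespace LogicProgram

variable {Atom : Type u}

/-! If `a` is derivable from the reduct of `P` relative to `X`, adding the fact `a` changes no
derivation. So let `X` be an answer set for the enlarged program in which `P` does not derive `a`;
it suffices to build an answer set for `P` omitting `a`. Order-consistency gives `a ∉ negDep P a`,
so on `negDep P a` the set `X` agrees with derivability in `P`. Off `posDep P a ∩ negDep P a` the
dependencies of `a` are signed, and Knaster–Tarski gives a stable set there whose positive part is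
derivable relative to `X`, hence omits `a` (`exists_isStableOn_union_dep`). Zorn's lemma extends it
to all atoms (`exists_isAnswerSet`). -/

/-- Derivability from the reduct of `P` relative to `X`. -/
inductive Derives (P : Program Atom) (X : Set Atom) : Atom → Prop
  | step {r : Rule Atom} (hr : r ∈ P) (hneg : ∀ c ∈ r.neg, c ∉ X)
      (hpos : ∀ b ∈ r.pos, Derives P X b) : Derives P X r.head

theorem isLeast_derives (P : Program Atom) (X : Set Atom) :
    IsPositiveAnswerSet (reduct P X) {b | Derives P X b} := by
  constructor
  · rintro _ ⟨r, hr, hneg, rfl⟩ hpos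
    exact Derives.step (r := r) hr hneg hpos
  · intro Y hY b hb
    induction hb with
    | @step r hr hneg _ ih => exact hY ⟨r.head, r.pos, ∅⟩ ⟨r, hr, hneg, rfl⟩ ih

theorem isAnswerSet_iff (P : Program Atom) (X : Set Atom) :
    IsAnswerSet P X ↔ ∀ b, b ∈ X ↔ Derives P X b := by
  constructor
  · intro h b
    have hX : X = {b | Derives P X b} := IsLeast.unique h (isLeast_derives P X)
    exact Set.ext_iff.1 hX b
  · intro h
    have hX : X = {b | Derives P X b} := Set.ext h
    have hl := isLeast_derives P X
    rw [← hX] at hl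
    exact hl

/-- Derivability of the atoms of `S` is antitone in the assumptions made on `T`, provided the
rules for `S` have their positive subgoals in `S` and their negated subgoals in `T`. -/
theorem Derives.anti {P : Program Atom} {S T X Y : Set Atom}
    (hS : ∀ r ∈ P, r.head ∈ S → (∀ b ∈ r.pos, b ∈ S) ∧ ∀ c ∈ r.neg, c ∈ T)
    (hYX : ∀ c ∈ T, c ∈ Y → c ∈ X) {b : Atom} (h : Derives P X b) (hb : b ∈ S) :
    Derives P Y b := by
  induction h with
  | @step r hr hneg _ ih =>
    exact .step hr (fun c hc hcY => hneg c hc (hYX c ((hS r hr hb).2 c hc) hcY))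
      fun b' hb' => ih b' hb' ((hS r hr hb).1 b' hb')

theorem Derives.mono_program {P Q : Program Atom} (hPQ : P ⊆ Q) {X : Set Atom} {b : Atom}
    (h : Derives P X b) : Derives Q X b := by
  induction h with
  | step hr hneg _ ih => exact .step (hPQ hr) hneg ih

/-- A set of atoms that contains all subgoals of the rules for its elements. -/
def IsSplitting (P : Program Atom) (U : Set Atom) : Prop :=
  ∀ r ∈ P, r.head ∈ U → (∀ b ∈ r.pos, b ∈ U) ∧ ∀ c ∈ r.neg, c ∈ U

theorem IsSplitting.derives_congr {P : Program Atom} {U X Y : Set Atom} (hU : IsSplitting P U)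
    (hXY : ∀ b ∈ U, b ∈ X ↔ b ∈ Y) {b : Atom} (hb : b ∈ U) :
    Derives P X b ↔ Derives P Y b :=
  ⟨fun h => h.anti hU (fun c hc => (hXY c hc).2) hb,
    fun h => h.anti hU (fun c hc => (hXY c hc).1) hb⟩

/-- `X` is a fixed point of the reduct operator on the atoms of `U`. -/
def IsStableOn (P : Program Atom) (U X : Set Atom) : Prop :=
  ∀ b ∈ U, b ∈ X ↔ Derives P X b

theorem isDepClosed_dep (P : Program Atom) (a : Atom) :
    IsDepClosed P a (posDep P a) (negDep P a) :=
  (isLeast_dep P a).1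

theorem isSplitting_inter_dep (P : Program Atom) (a : Atom) :
    IsSplitting P (posDep P a ∩ negDep P a) := fun r hr h =>
  have hp := ((isDepClosed_dep P a).2 r hr).1 h.1
  have hn := ((isDepClosed_dep P a).2 r hr).2 h.2
  ⟨fun b hb => ⟨hp.1 b hb, hn.1 b hb⟩, fun c hc => ⟨hn.2 c hc, hp.2 c hc⟩⟩

theorem IsSplitting.union_dep {P : Program Atom} {U : Set Atom} (hU : IsSplitting P U)
    (a : Atom) : IsSplitting P (U ∪ (posDep P a ∪ negDep P a)) := by
  rintro r hr (h | h | h)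
  · exact ⟨fun b hb => .inl ((hU r hr h).1 b hb), fun c hc => .inl ((hU r hr h).2 c hc)⟩
  · have hp := ((isDepClosed_dep P a).2 r hr).1 h
    exact ⟨fun b hb => .inr (.inl (hp.1 b hb)), fun c hc => .inr (.inr (hp.2 c hc))⟩
  · have hn := ((isDepClosed_dep P a).2 r hr).2 h
    exact ⟨fun b hb => .inr (.inr (hn.1 b hb)), fun c hc => .inr (.inl (hn.2 c hc))⟩

/-- Outside a splitting set containing `posDep P a ∩ negDep P a`, the rules for the dependencies
of `a` form a signed program, so that the reduct operator is monotone once the order is reversed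
on `negDep P a`. Below a pre-fixed point it has a fixed point. -/
theorem exists_isStableOn_union_dep {P : Program Atom} {U X : Set Atom} {a : Atom}
    (hU : IsSplitting P U) (hX : IsStableOn P U X) (ha : posDep P a ∩ negDep P a ⊆ U)
    (hpos : ∀ b ∈ posDep P a, Derives P X b → b ∈ X)
    (hneg : ∀ b ∈ negDep P a, b ∈ X → Derives P X b) :
    ∃ Z : Set Atom, (∀ b ∈ U, b ∈ Z ↔ b ∈ X) ∧
      IsStableOn P (U ∪ (posDep P a ∪ negDep P a)) Z ∧
      ∀ b ∈ posDep P a, b ∈ Z → Derives P X b := by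
  set S := posDep P a
  set T := negDep P a
  have hdisj : ∀ b, b ∉ U → b ∈ S → b ∉ T := fun b h h1 h2 => h (ha ⟨h1, h2⟩)
  have hcl := (isDepClosed_dep P a).2
  have hS : ∀ r ∈ P, r.head ∈ S ∪ U →
      (∀ b ∈ r.pos, b ∈ S ∪ U) ∧ ∀ c ∈ r.neg, c ∈ T ∪ U := by
    rintro r hr (h | h)
    · exact ⟨fun b hb => .inl (((hcl r hr).1 h).1 b hb),
        fun b hb => .inl (((hcl r hr).1 h).2 b hb)⟩
    · exact ⟨fun b hb => .inr ((hU r hr h).1 b hb), fun b hb => .inr ((hU r hr h).2 b hb)⟩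
  have hT : ∀ r ∈ P, r.head ∈ T ∪ U →
      (∀ b ∈ r.pos, b ∈ T ∪ U) ∧ ∀ c ∈ r.neg, c ∈ S ∪ U := by
    rintro r hr (h | h)
    · exact ⟨fun b hb => .inl (((hcl r hr).2 h).1 b hb),
        fun b hb => .inl (((hcl r hr).2 h).2 b hb)⟩
    · exact ⟨fun b hb => .inr ((hU r hr h).1 b hb), fun b hb => .inr ((hU r hr h).2 b hb)⟩
  -- `W` encodes an interpretation: literally on `S`, complemented on `T`. On `U` the values are
  -- frozen to those of `X`.
  let D : Set Atom → Set Atom := fun W =>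
    {b | (b ∈ U ∧ b ∈ X) ∨ (b ∉ U ∧ b ∈ S ∧ b ∈ W) ∨ (b ∉ U ∧ b ∈ T ∧ b ∉ W)}
  have memU : ∀ W, ∀ b ∈ U, b ∈ D W ↔ b ∈ X := fun W b hb => by simp [D, hb]
  have memS : ∀ W b, b ∉ U → b ∈ S → (b ∈ D W ↔ b ∈ W) := fun W b hb h => by
    simp [D, hb, h, hdisj b hb h]
  have memT : ∀ W b, b ∉ U → b ∈ T → (b ∈ D W ↔ b ∉ W) := fun W b hb h => by
    have : b ∉ S := fun h' => hdisj b hb h' h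
    simp [D, hb, h, this]
  let F : Set Atom →o Set Atom :=
    { toFun := fun W => {b | b ∉ U ∧ ((b ∈ S ∧ Derives P (D W) b) ∨
        (b ∈ T ∧ ¬ Derives P (D W) b))}
      monotone' := by
        rintro V W hVW b ⟨hbU, ⟨hb, h⟩ | ⟨hb, h⟩⟩
        · refine ⟨hbU, .inl ⟨hb, h.anti hS ?_ (.inl hb)⟩⟩
          intro c hc hcW
          by_cases hcU : c ∈ U
          · exact (memU V c hcU).2 ((memU W c hcU).1 hcW)
          · have hcT := hc.resolve_right hcU
            exact (memT V c hcU hcT).2 fun h' => (memT W c hcU hcT).1 hcW (hVW h')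
        · refine ⟨hbU, .inr ⟨hb, fun h' => h (h'.anti hT ?_ (.inl hb))⟩⟩
          intro c hc hcV
          by_cases hcU : c ∈ U
          · exact (memU W c hcU).2 ((memU V c hcU).1 hcV)
          · have hcS := hc.resolve_right hcU
            exact (memS W c hcU hcS).2 (hVW ((memS V c hcU hcS).1 hcV)) }
  have hfix : F F.lfp = F.lfp := F.map_lfp
  set W := F.lfp with hW
  have hWmem : ∀ b, b ∈ W ↔ b ∉ U ∧ ((b ∈ S ∧ Derives P (D W) b) ∨
      (b ∈ T ∧ ¬ Derives P (D W) b)) := fun b => (Set.ext_iff.1 hfix b).symm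
  -- `V` is the code of `X`; `hpos` and `hneg` say exactly that `F V ⊆ V`.
  let V : Set Atom := {b | b ∉ U ∧ ((b ∈ S ∧ b ∈ X) ∨ (b ∈ T ∧ b ∉ X))}
  have hV : ∀ c ∈ S ∪ T ∪ U, c ∈ D V ↔ c ∈ X := by
    intro c hc
    by_cases hcU : c ∈ U
    · exact memU V c hcU
    · rcases hc.resolve_right hcU with h | h
      · rw [memS V c hcU h]
        simp [V, hcU, h, hdisj c hcU h]
      · rw [memT V c hcU h]
        have : c ∉ S := fun h' => hdisj c hcU h' h
        simp [V, hcU, h, this]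
  have hWV : W ⊆ V := by
    refine F.lfp_le ?_
    rintro b ⟨hbU, ⟨hb, h⟩ | ⟨hb, h⟩⟩
    · refine ⟨hbU, .inl ⟨hb, hpos b hb (h.anti hS (fun c hc => (hV c ?_).2) (.inl hb))⟩⟩
      exact hc.imp_left .inr
    · refine ⟨hbU, .inr ⟨hb, fun h' => h ((hneg b hb h').anti hT (fun c hc => (hV c ?_).1)
        (.inl hb))⟩⟩
      exact hc.imp_left .inl
  have hst : IsStableOn P (U ∪ (S ∪ T)) (D W) := by
    intro b hb
    by_cases hbU : b ∈ U
    · rw [memU W b hbU, hX b hbU]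
      exact hU.derives_congr (fun c hc => (memU W c hc).symm) hbU
    · rcases hb.resolve_left hbU with h | h
      · rw [memS W b hbU h, hWmem b]
        simp [hbU, h, hdisj b hbU h]
      · rw [memT W b hbU h, hWmem b]
        have : b ∉ S := fun h' => hdisj b hbU h' h
        simp [hbU, h, this]
  refine ⟨D W, memU W, hst, fun b hb h => ?_⟩
  -- One more use of antitonicity bounds `D W` on `S` by what is derivable from `X`, not merely by
  -- `X`. The sharper bound matters when `a ∈ X` is not derivable.
  refine ((hst b (.inr (.inl hb))).1 h).anti hS (fun c hc hcX => ?_) (.inl hb)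
  by_cases hcU : c ∈ U
  · exact (memU W c hcU).2 hcX
  · have hcT := hc.resolve_right hcU
    exact (memT W c hcU hcT).2 fun h' =>
      (memT V c hcU hcT).1 ((hV c (.inl (.inr hcT))).2 hcX) (hWV h')

/-- A partial answer set, defined on a splitting set of an order-consistent program, extends to an
answer set. -/
theorem IsOrderConsistent.exists_isAnswerSet {P : Program Atom} (hP : IsOrderConsistent P)
    {U X : Set Atom} (hU : IsSplitting P U) (hX : IsStableOn P U X) :
    ∃ Z, IsAnswerSet P Z ∧ ∀ b ∈ U, b ∈ Z ↔ b ∈ X := by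
  let C := {p : Set Atom × Set Atom // IsSplitting P p.1 ∧ IsStableOn P p.1 p.2 ∧
    U ⊆ p.1 ∧ ∀ b ∈ U, b ∈ p.2 ↔ b ∈ X}
  -- Partial answer sets ordered by extension, for Zorn's lemma.
  let R : C → C → Prop := fun p q => p.1.1 ⊆ q.1.1 ∧ ∀ b ∈ p.1.1, b ∈ q.1.2 ↔ b ∈ p.1.2
  have hrefl : ∀ p, R p p := fun p => ⟨subset_rfl, fun _ _ => Iff.rfl⟩
  have htrans : ∀ {p q s : C}, R p q → R q s → R p s := fun hpq hqs =>
    ⟨hpq.1.trans hqs.1, fun b hb => (hqs.2 b (hpq.1 hb)).trans (hpq.2 b hb)⟩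
  obtain ⟨m, hm⟩ : ∃ m, ∀ q, R m q → R q m := by
    refine exists_maximal_of_chains_bounded (fun c hc => ?_) htrans
    rcases c.eq_empty_or_nonempty with rfl | ⟨p₀, hp₀⟩
    · exact ⟨⟨(U, X), hU, hX, subset_rfl, fun _ _ => Iff.rfl⟩, by simp⟩
    let V : Set Atom := {b | ∃ p ∈ c, b ∈ p.1.1}
    let Y : Set Atom := {b | ∃ p ∈ c, b ∈ p.1.1 ∧ b ∈ p.1.2}
    have hY : ∀ p ∈ c, ∀ b ∈ p.1.1, b ∈ Y ↔ b ∈ p.1.2 := by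
      intro p hp b hb
      refine ⟨?_, fun h => ⟨p, hp, hb, h⟩⟩
      rintro ⟨q, hq, hbq, h⟩
      rcases eq_or_ne p q with rfl | hne
      · exact h
      · rcases hc hp hq hne with h' | h'
        · exact (h'.2 b hb).1 h
        · exact (h'.2 b hbq).2 h
    refine ⟨⟨(V, Y), ?_, ?_, ?_, ?_⟩, fun p hp => ⟨fun b hb => ⟨p, hp, hb⟩, hY p hp⟩⟩
    · rintro r hr ⟨p, hp, h⟩
      exact ⟨fun b hb => ⟨p, hp, (p.2.1 r hr h).1 b hb⟩,
        fun b hb => ⟨p, hp, (p.2.1 r hr h).2 b hb⟩⟩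
    · rintro b ⟨p, hp, h⟩
      rw [p.2.1.derives_congr (hY p hp) h]
      exact (hY p hp b h).trans (p.2.2.1 b h)
    · exact fun b hb => ⟨p₀, hp₀, p₀.2.2.2.1 hb⟩
    · exact fun b hb => (hY p₀ hp₀ b (p₀.2.2.2.1 hb)).trans (p₀.2.2.2.2 b hb)
  obtain ⟨⟨V, Y⟩, hV, hY, hUV, hYX⟩ := m
  have huniv : ∀ b, b ∈ V := by
    by_contra! hne
    obtain ⟨level, hlevel⟩ := hP
    let N : Set Atom := {b | b ∉ V}
    have hN : N.Nonempty := hne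
    have wf : WellFounded fun x y : Atom => level x < level y := InvImage.wf level wellFounded_lt
    -- By minimality of the level, every atom on which `a` depends with both signs is already
    -- decided.
    set a := wf.min N hN
    have haV : a ∉ V := wf.min_mem N hN
    have hsub : posDep P a ∩ negDep P a ⊆ V := by
      intro b hb
      by_contra hbV
      exact wf.not_lt_min N hbV (hlevel a b hb)
    -- Making all undecided positive dependencies true and all other undecided atoms false gives a
    -- trivial pre-fixed point.
    let Y' : Set Atom := {b | (b ∈ V ∧ b ∈ Y) ∨ (b ∉ V ∧ b ∈ posDep P a)}
    have hY' : ∀ b ∈ V, b ∈ Y' ↔ b ∈ Y := fun b hb => by simp [Y', hb]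
    have hst : IsStableOn P V Y' := fun b hb => by
      rw [hY' b hb, hY b hb]
      exact (hV.derives_congr hY' hb).symm
    obtain ⟨Z, hZY, hZ, -⟩ := exists_isStableOn_union_dep hV hst hsub
      (fun b hb h => by
        by_cases hbV : b ∈ V
        · exact (hst b hbV).2 h
        · exact .inr ⟨hbV, hb⟩)
      (fun b hb h => by
        rcases id h with ⟨hbV, -⟩ | ⟨hbV, hbS⟩
        · exact (hst b hbV).1 h
        · exact absurd (hsub ⟨hbS, hb⟩) hbV)
    have hZY' : ∀ b ∈ V, b ∈ Z ↔ b ∈ Y := fun b hb => (hZY b hb).trans (hY' b hb)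
    have hle := hm ⟨(V ∪ (posDep P a ∪ negDep P a), Z), hV.union_dep a, hZ,
      hUV.trans Set.subset_union_left,
      fun b hb => (hZY' b (hUV hb)).trans (hYX b hb)⟩ ⟨Set.subset_union_left, hZY'⟩
    exact haV (hle.1 (.inr (.inl .self)))
  exact ⟨Y, (isAnswerSet_iff P Y).2 fun b => hY b (huniv b), hYX⟩

theorem Derives.of_union_fact {P : Program Atom} {X : Set Atom} {a : Atom}
    (ha : Derives P X a) {b : Atom} (h : Derives (P ∪ {fact a}) X b) : Derives P X b := by
  induction h with
  | step hr hneg _ ih =>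
    rcases hr with hr | rfl
    · exact .step hr hneg ih
    · exact ha

/-- A derivation of an atom of `T` stays inside `T`, so it never uses the fact `a`. -/
theorem Derives.of_union_fact_of_notMem {P : Program Atom} {X T : Set Atom} {a : Atom}
    (haT : a ∉ T) (hT : ∀ r ∈ P, r.head ∈ T → ∀ b ∈ r.pos, b ∈ T) {b : Atom}
    (h : Derives (P ∪ {fact a}) X b) (hb : b ∈ T) : Derives P X b := by
  induction h with
  | step hr hneg _ ih =>
    rcases hr with hr | rfl
    · exact .step hr hneg fun b' hb' => ih b' hb' (hT _ hr hb b' hb')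
    · exact absurd hb haT

/-- An answer set for `P ∪ {fact a}` that does not support `a` in `P` yields an answer set for `P`
without `a`. -/
theorem IsOrderConsistent.exists_isAnswerSet_notMem {P : Program Atom}
    (hP : IsOrderConsistent P) {X : Set Atom} {a : Atom}
    (hX : ∀ b, b ∈ X ↔ Derives (P ∪ {fact a}) X b) (ha : ¬ Derives P X a) :
    ∃ Z, IsAnswerSet P Z ∧ a ∉ Z := by
  have haT : a ∉ negDep P a := fun h => by
    obtain ⟨level, hlevel⟩ := hP
    exact lt_irrefl _ (hlevel a a ⟨.self, h⟩)
  have hle : ∀ b, Derives P X b → b ∈ X := fun b h =>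
    (hX b).2 (h.mono_program Set.subset_union_left)
  have hge : ∀ b ∈ negDep P a, b ∈ X → Derives P X b := fun b hb h =>
    ((hX b).1 h).of_union_fact_of_notMem haT
      (fun r hr hh => (((isDepClosed_dep P a).2 r hr).2 hh).1) hb
  have hL := isSplitting_inter_dep P a
  obtain ⟨Y, -, hY, hYX⟩ := exists_isStableOn_union_dep (X := X) hL
    (fun b hb => ⟨hge b hb.2, hle b⟩) subset_rfl (fun b _ => hle b) hge
  obtain ⟨Z, hZ, hZY⟩ := hP.exists_isAnswerSet (hL.union_dep a) hY
  exact ⟨Z, hZ, fun h => ha (hYX a .self ((hZY a (.inr (.inl .self))).1 h))⟩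

end LogicProgram

theorem mainTheorem2 {Atom : Type u} (P : LogicProgram.Program Atom)
    (hP : LogicProgram.IsOrderConsistent P) (a : Atom)
    (ha : ∀ X : Set Atom, LogicProgram.IsAnswerSet P X → a ∈ X) :
    ∀ X : Set Atom,
      LogicProgram.IsAnswerSet P X ↔
        LogicProgram.IsAnswerSet (P ∪ {LogicProgram.fact a}) X := by
  intro X
  have key : LogicProgram.Derives P X a → ∀ b, LogicProgram.Derives P X b ↔
      LogicProgram.Derives (P ∪ {LogicProgram.fact a}) X b := fun h b =>
    ⟨fun h' => h'.mono_program Set.subset_union_left, fun h' => h.of_union_fact h'⟩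
  constructor
  · intro h
    have haX := ha X h
    rw [LogicProgram.isAnswerSet_iff] at h ⊢
    exact fun b => (h b).trans (key ((h a).1 haX) b)
  · intro h
    rw [LogicProgram.isAnswerSet_iff] at h ⊢
    have hd : LogicProgram.Derives P X a := by
      by_contra hd
      obtain ⟨Z, hZ, haZ⟩ := hP.exists_isAnswerSet_notMem h hd
      exact haZ (ha Z hZ)
    exact fun b => (h b).trans (key hd b).symm
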